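/- Let $M=(M_j)_{j\ge 0}$ be a nondecreasing sequence of real numbers with $M_0=1$ which is logarithmically convex, i.e. $M_{j+1}^2\le M_jM_{j+2}$ for all $j\ge 0$. For $n\ge 0$, let $\mathcal{O}_n$ be the ring of complex-valued real-analytic function germs at the origin of $\mathbb{R}^n$, and let $\mathcal{E}_n(M)$ be the ring of complex-valued $C^\infty$ function germs $f$ at the origin of $\mathbb{R}^n$ for which there are a neighborhood $U$ of $0$ and constants $C,\sigma>0$ such that $|D^Jf(x)|\le C\sigma^{j}\,j!\,M_{j}$ for all multi-indices $J\in\mathbb{N}^n$, with $j=|J|$, and all $x\in U$. Say that $\mathcal{E}_n(M)$ is quasianalytic if the only $f\in\mathcal{E}_n(M)$ with $D^Jf(0)=0$ for all $J\in\mathbb{N}^n$ is $f=0$. Let $n\ge 1$, write $x=(x',x_n)\in\mathbb{R}^{n-1}\times\mathbb{R}$, and let $\varphi\in\mathcal{E}_{n-1}(M)[x_n]$ be a distinguished polynomial, i.e. $\varphi(x)=x_n^d+a_1(x')x_n^{d-1}+\cdots+a_d(x')$ with $a_j\in\mathcal{E}_{n-1}(M)$ and $a_j(0)=0$ for $1\le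 j\le d$. **Theorem 3.3 (Childress).** Suppose that $\mathcal{E}_n(M)$ is quasianalytic, that $\mathcal{O}_n\subsetneq\mathcal{E}_n(M)$, and that Weierstrass division holds in $\mathcal{E}_n(M)$ for the divisor $\varphi$, i.e. for every $f\in\mathcal{E}_n(M)$ there are $g\in\mathcal{E}_n(M)$ and $h_0,\ldots,h_{d-1}\in\mathcal{E}_{n-1}(M)$ with $$f(x)=\varphi(x)\,g(x)+\sum_{j=0}^{d-1}h_j(x')\,x_n^j .$$ Then $\varphi$ is hyperbolic: there is a neighborhood $U$ of $0$ in $\mathbb{R}^{n-1}$ such that for every $x'\in U$ all complex roots of $\varphi(x',\cdot)$ are real. -/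

import Mathlib

open Filter Topology
open scoped ContDiff

/-- The standing assumptions on the weight sequence `M`: it is increasing (in the wide sense),
`M 0 = 1`, and it is logarithmically convex, that is, `M (j + 1) / M j` increases. -/
structure IsWeightSequence (M : ℕ → ℝ) : Prop where
  zero : M 0 = 1
  mono : Monotone M
  logConvex : ∀ j, M (j + 1) ^ 2 ≤ M j * M (j + 2)

/-- The partial derivative `∂ʲf / ∂x_{i 0} ⋯ ∂x_{i (j - 1)}` at `x`, where `i` lists the `j` directions
of differentiation. When `f` is smooth near `x` it does not depend on the order of the list, so that
the lists of length `j` give exactly the derivatives `D^J f(x)` with `J ∈ ℕⁿ` of length `j`. -/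
noncomputable def partialDerivative {n j : ℕ} (i : Fin j → Fin n) (f : (Fin n → ℝ) → ℂ)
    (x : Fin n → ℝ) : ℂ :=
  iteratedFDeriv ℝ j f x (fun k => Pi.single (i k) (1 : ℝ))

/-- The representatives of the elements of `𝓔ₙ(M)`: complex-valued functions which are `C^∞` in an
open neighborhood `U` of the origin of `ℝⁿ` with `|D^J f(x)| ≤ C σ^j j! M_j` for all multi-indices `J`
of length `j`, all `j`, and all `x ∈ U`. Germs at the origin are handled through their
representatives, and equality of germs is `=ᶠ[𝓝 0]`; membership depends only on the germ. -/
def carlemanGerms (n : ℕ) (M : ℕ → ℝ) : Set ((Fin n → ℝ) → ℂ) :=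
  {f | ∃ U : Set (Fin n → ℝ), IsOpen U ∧ 0 ∈ U ∧ ContDiffOn ℝ ∞ f U ∧
    ∃ C > 0, ∃ σ > 0, ∀ (j : ℕ) (i : Fin j → Fin n), ∀ x ∈ U,
      ‖partialDerivative i f x‖ ≤ C * σ ^ j * (j.factorial : ℝ) * M j}

/-- The representatives of the elements of `𝓞ₙ`, the complex-valued real-analytic germs at the origin
of `ℝⁿ`. -/
def analyticGerms (n : ℕ) : Set ((Fin n → ℝ) → ℂ) :=
  {f | AnalyticAt ℝ f 0}

/-- `𝓔ₙ(M)` is quasianalytic: an element all of whose derivatives vanish at the origin is the zero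
germ. -/
def IsQuasianalytic (n : ℕ) (M : ℕ → ℝ) : Prop :=
  ∀ f ∈ carlemanGerms n M,
    (∀ (j : ℕ) (i : Fin j → Fin n), partialDerivative i f 0 = 0) → f =ᶠ[𝓝 0] 0

/-- Weierstrass division holds in `𝓔ₘ₊₁(M)` for the divisor `φ`, where `d` is the order of regularity
of `φ` with respect to the last variable. Here `x = (x', xₙ)` with `x' = Fin.init x` and
`xₙ = x (Fin.last m)`. -/
def WeierstrassDivisionHolds {m : ℕ} (M : ℕ → ℝ) (d : ℕ) (φ : (Fin (m + 1) → ℝ) → ℂ) : Prop :=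
  ∀ f ∈ carlemanGerms (m + 1) M,
    ∃ g ∈ carlemanGerms (m + 1) M, ∃ h : Fin d → ((Fin m → ℝ) → ℂ),
      (∀ j, h j ∈ carlemanGerms m M) ∧
      f =ᶠ[𝓝 0] fun x => φ x * g x +
        ∑ j : Fin d, h j (Fin.init (α := fun _ => ℝ) x) * (x (Fin.last m) : ℂ) ^ (j : ℕ)

/-- The value at `(x', z)` of the monic polynomial `z^d + a₁(x') z^(d-1) + ⋯ + a_d(x')`. The entry
`a j` of the family, `0 ≤ j < d`, stands for the coefficient `a_{j+1}`. -/
noncomputable def monicPoly {m d : ℕ} (a : Fin d → ((Fin m → ℝ) → ℂ)) (x' : Fin m → ℝ) (z : ℂ) : ℂ :=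
  z ^ d + ∑ j : Fin d, a j x' * z ^ (d - ((j : ℕ) + 1))

/-- The germ `φ(x) = xₙ^d + a₁(x') xₙ^(d-1) + ⋯ + a_d(x')` on `ℝᵐ⁺¹` defined by the polynomial. -/
noncomputable def monicPolyGerm {m d : ℕ} (a : Fin d → ((Fin m → ℝ) → ℂ)) (x : Fin (m + 1) → ℝ) : ℂ :=
  monicPoly a (Fin.init (α := fun _ => ℝ) x) (x (Fin.last m) : ℂ)

/-- The polynomial with coefficients `a₁, …, a_d` is distinguished in `𝓔ₘ(M)[xₙ]`: its coefficients
belong to `𝓔ₘ(M)` and vanish at the origin. -/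
def IsDistinguished {m d : ℕ} (M : ℕ → ℝ) (a : Fin d → ((Fin m → ℝ) → ℂ)) : Prop :=
  ∀ j, a j ∈ carlemanGerms m M ∧ a j 0 = 0

/-- The polynomial is hyperbolic: for all `x'` in some neighborhood of the origin, every complex root
of `φ(x', ·)` is real. -/
def IsHyperbolic {m d : ℕ} (a : Fin d → ((Fin m → ℝ) → ℂ)) : Prop :=
  ∃ U ∈ 𝓝 (0 : Fin m → ℝ), ∀ x' ∈ U, ∀ z : ℂ, monicPoly a x' z = 0 → z.im = 0

/-! At a root `z` of `φ(x', ·)`, dividing `f` by `φ` should give `f(z) = ∑ h_j(x') z^j`. For a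
polynomial `P` in the last variable this makes sense at a nonreal `z`. It holds for the remainder of
Euclidean division over the ring of Carleman coefficients, so it holds for the given remainder as
soon as division is unique (`eval_eq_sum_of_root`). Uniqueness is tested along a line `t ↦ t v`. At
`t = 0` the divisor is `x^d`, so the Taylor coefficients in `t` of two remainders agree order by
order (`iteratedDeriv_eq_zero_of_division`), and quasianalyticity then makes the remainders equal
(`IsQuasianalytic.eq_zero_of_flat`).

Baire's theorem makes the bounds on the remainders uniform. Absolutely summable series of
polynomials obeying fixed Carleman bounds form a Banach space, covered by the sets `divisibleSeries
M a N`. These are closed by compactness, so one of them contains a ball. Subtracting two divisions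
in that ball divides every such polynomial with the same constants, hence `|P(z)|` is bounded
independently of `P`, for all `x'` in one neighborhood.

This fails if `z` is not real. Since some Carleman germ is not analytic, `M` dominates every
geometric sequence, so by Cauchy's estimates a polynomial bounded on a thin complex neighborhood of
`(-1, 1)` satisfies the Carleman bounds up to a constant depending only on the width. Powers of `1 -
((ζ - Re z) / L)²` grow faster at `z` than on that neighborhood (`smul_pow_mem_unitPolynomials`). -/

/-! ### Smooth functions with prescribed derivative bounds, and their compactness -/

/-- The interval `(-1, 1)`. -/
abbrev symmInterval : Set ℝ := Set.Ioo (-1) 1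

/-- The smooth functions on `(-1, 1)` whose derivative of order `k` is bounded by `B k`. -/
def boundedJets (B : ℕ → ℝ) : Set (ℝ → ℂ) :=
  {w | ContDiffOn ℝ ∞ w symmInterval ∧
    ∀ k, ∀ t ∈ symmInterval, ‖iteratedDeriv k w t‖ ≤ B k}

theorem ContDiffOn.hasDerivAt_iteratedDeriv {w : ℝ → ℂ} {s : Set ℝ} (hs : IsOpen s)
    (hw : ContDiffOn ℝ ∞ w s) (k : ℕ) {t : ℝ} (ht : t ∈ s) :
    HasDerivAt (iteratedDeriv k w) (iteratedDeriv (k + 1) w t) t := by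
  have h := (hw.differentiableOn_iteratedDerivWithin (m := k)
    (by exact_mod_cast ENat.natCast_lt_top k) hs.uniqueDiffOn).congr
    (fun x hx => (iteratedDerivWithin_of_isOpen hs hx).symm)
  rw [iteratedDeriv_succ]
  exact ((h t ht).differentiableAt (hs.mem_nhds ht)).hasDerivAt

theorem iteratedDeriv_eqOn_of_chain {u : ℕ → ℝ → ℂ} {s : Set ℝ} (hs : IsOpen s)
    (hu : ∀ k, ∀ t ∈ s, HasDerivAt (u k) (u (k + 1) t) t) (k : ℕ) :
    Set.EqOn (iteratedDeriv k (u 0)) (u k) s := by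
  induction k with
  | zero => intro t _; simp
  | succ k ih =>
    intro t ht
    rw [iteratedDeriv_succ, (ih.eventuallyEq_of_mem (hs.mem_nhds ht)).deriv_eq]
    exact (hu k t ht).deriv

theorem contDiffOn_of_chain {u : ℕ → ℝ → ℂ} {s : Set ℝ} (hs : IsOpen s)
    (hu : ∀ k, ∀ t ∈ s, HasDerivAt (u k) (u (k + 1) t) t) : ContDiffOn ℝ ∞ (u 0) s := by
  refine contDiffOn_of_differentiableOn_deriv fun k _ => ?_
  have h : DifferentiableOn ℝ (u k) s := fun t ht =>
    (hu k t ht).differentiableAt.differentiableWithinAt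
  exact h.congr fun t ht =>
    (iteratedDerivWithin_of_isOpen hs ht).trans (iteratedDeriv_eqOn_of_chain hs hu k ht)

/-- Lets candidate derivatives (limits, termwise sums, directional derivatives) be recognized as the
iterated derivatives without computing those. -/
theorem mem_boundedJets_of_chain {u : ℕ → ℝ → ℂ} {B : ℕ → ℝ}
    (hu : ∀ k, ∀ t ∈ symmInterval, HasDerivAt (u k) (u (k + 1) t) t)
    (hB : ∀ k, ∀ t ∈ symmInterval, ‖u k t‖ ≤ B k) : u 0 ∈ boundedJets B :=
  ⟨contDiffOn_of_chain isOpen_Ioo hu, fun k t ht => by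
    rw [iteratedDeriv_eqOn_of_chain isOpen_Ioo hu k ht]; exact hB k t ht⟩

theorem boundedJets_mono {B B' : ℕ → ℝ} (h : ∀ k, B k ≤ B' k) :
    boundedJets B ⊆ boundedJets B' :=
  fun _ hw => ⟨hw.1, fun k t ht => (hw.2 k t ht).trans (h k)⟩

theorem ContDiffOn.contDiffAt_symmInterval {w : ℝ → ℂ} (hw : ContDiffOn ℝ ∞ w symmInterval)
    (k : ℕ) {t : ℝ} (ht : t ∈ symmInterval) : ContDiffAt ℝ k w t :=
  (hw.contDiffAt (isOpen_Ioo.mem_nhds ht)).of_le (by exact_mod_cast le_top)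

theorem taylor_bound_of_mem_boundedJets {B : ℕ → ℝ} {w : ℝ → ℂ} (hw : w ∈ boundedJets B)
    (k : ℕ) {s t : ℝ} (hs : s ∈ symmInterval) (ht : t ∈ symmInterval) :
    ‖iteratedDeriv k w t - iteratedDeriv k w s - (t - s) • iteratedDeriv (k + 1) w s‖
      ≤ B (k + 2) * |t - s| ^ 2 := by
  have hsub : Set.uIcc s t ⊆ symmInterval := (convex_Ioo _ _).ordConnected.uIcc_subset hs ht
  have hd := fun k x hx => hw.1.hasDerivAt_iteratedDeriv isOpen_Ioo k (t := x) (hsub hx)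
  have hB : 0 ≤ B (k + 2) := (norm_nonneg _).trans (hw.2 (k + 2) s hs)
  have h1 : ∀ x ∈ Set.uIcc s t,
      ‖iteratedDeriv (k + 1) w x - iteratedDeriv (k + 1) w s‖ ≤ B (k + 2) * |t - s| := by
    intro x hx
    refine ((convex_uIcc s t).norm_image_sub_le_of_norm_hasDerivWithin_le
      (fun y hy => (hd (k + 1) y hy).hasDerivWithinAt) (fun y hy => hw.2 _ y (hsub hy))
      Set.left_mem_uIcc hx).trans ?_
    gcongr
    exact Set.abs_sub_left_of_mem_uIcc hx
  have h2 := (convex_uIcc s t).norm_image_sub_le_of_norm_hasDerivWithin_le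
    (f := fun x => iteratedDeriv k w x - (x - s) • iteratedDeriv (k + 1) w s)
    (f' := fun x => iteratedDeriv (k + 1) w x - iteratedDeriv (k + 1) w s)
    (fun x hx => by
      have := (hd k x hx).sub
        (((hasDerivAt_id x).sub_const s).smul_const (iteratedDeriv (k + 1) w s))
      rw [one_smul] at this
      exact this.hasDerivWithinAt)
    h1 Set.left_mem_uIcc Set.right_mem_uIcc
  simp only [sub_self, zero_smul, sub_zero, Real.norm_eq_abs] at h2
  calc _ = _ := by congr 1; ring
    _ ≤ _ := h2
    _ = _ := by ring

theorem hasDerivAt_of_quadratic_bound {f : ℝ → ℂ} {f' : ℂ} {C t : ℝ}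
    (h : ∀ᶠ y in 𝓝 t, ‖f y - f t - (y - t) • f'‖ ≤ C * |y - t| ^ 2) : HasDerivAt f f' t := by
  rw [hasDerivAt_iff_isLittleO]
  have h1 : (fun y => f y - f t - (y - t) • f') =O[𝓝 t] fun y => (y - t) * (y - t) := by
    refine Asymptotics.IsBigO.of_bound C (h.mono fun y hy => ?_)
    simpa [sq] using hy
  refine h1.trans_isLittleO ?_
  have h2 : (fun y : ℝ => y - t) =o[𝓝 t] fun _ => (1 : ℝ) := by
    rw [Asymptotics.isLittleO_one_iff]
    have : Tendsto (fun y : ℝ => y - t) (𝓝 t) (𝓝 (t - t)) :=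
      (continuous_id.sub continuous_const).tendsto t
    simpa using this
  simpa using (Asymptotics.isBigO_refl (fun y : ℝ => y - t) (𝓝 t)).mul_isLittleO h2

/-- Substitute for Arzelà–Ascoli: along an ultrafilter every bounded sequence of derivatives
converges pointwise, and no subsequence is needed. The limits are derivatives of one another because
the Taylor estimate has a constant independent of `i`, so it survives the limit. -/
theorem exists_tendsto_mem_boundedJets {ι : Type*} (l : Ultrafilter ι) {B : ℕ → ℝ}
    {w : ι → ℝ → ℂ} (hw : ∀ i, w i ∈ boundedJets B) :
    ∃ w' ∈ boundedJets B, ∀ t ∈ symmInterval, Tendsto (fun i => w i t) l (𝓝 (w' t)) := by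
  have hlim : ∀ (k : ℕ) (t : ℝ), ∃ z : ℂ, t ∈ symmInterval →
      ‖z‖ ≤ B k ∧ Tendsto (fun i => iteratedDeriv k (w i) t) l (𝓝 z) := by
    intro k t
    by_cases ht : t ∈ symmInterval
    · obtain ⟨z, hz, hzl⟩ := (isCompact_closedBall (0 : ℂ) (B k)).ultrafilter_le_nhds
        (l.map fun i => iteratedDeriv k (w i) t)
        (by
          rw [le_principal_iff]
          refine Ultrafilter.mem_map.2 (Filter.univ_mem' fun i => ?_)
          simpa using (hw i).2 k t ht)
      exact ⟨z, fun _ => ⟨by simpa using hz, hzl⟩⟩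
    · exact ⟨0, fun h => absurd h ht⟩
  choose u hu using hlim
  refine ⟨u 0, mem_boundedJets_of_chain (fun k t ht => ?_) fun k t ht => (hu k t ht).1,
    fun t ht => by simpa using (hu 0 t ht).2⟩
  refine hasDerivAt_of_quadratic_bound (C := B (k + 2)) ?_
  filter_upwards [isOpen_Ioo.mem_nhds ht] with y hy
  refine le_of_tendsto ((((hu k y hy).2.sub (hu k t ht).2).sub
    ((hu (k + 1) t ht).2.const_smul (y - t))).norm) (Eventually.of_forall fun i => ?_)
  exact taylor_bound_of_mem_boundedJets (hw i) k ht hy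

/-! ### Growth of the weight sequence -/

namespace IsWeightSequence

variable {M : ℕ → ℝ}

theorem one_le (hM : IsWeightSequence M) (j : ℕ) : 1 ≤ M j := hM.zero ▸ hM.mono (Nat.zero_le j)

theorem pos (hM : IsWeightSequence M) (j : ℕ) : 0 < M j := one_pos.trans_le (hM.one_le j)

theorem ratio_mono (hM : IsWeightSequence M) : Monotone fun j => M (j + 1) / M j := by
  refine monotone_nat_of_le_succ fun j => ?_
  rw [div_le_div_iff₀ (hM.pos _) (hM.pos _)]
  nlinarith [hM.logConvex j]

theorem mul_le (hM : IsWeightSequence M) (k l : ℕ) : M k * M l ≤ M (k + l) := by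
  induction l with
  | zero => simp [hM.zero]
  | succ l ih =>
    have h := hM.ratio_mono (Nat.le_add_left l k)
    simp only at h
    rw [div_le_div_iff₀ (hM.pos _) (hM.pos _)] at h
    have h1 : M k * M (l + 1) * M l ≤ M (k + (l + 1)) * M l := by
      calc M k * M (l + 1) * M l = (M k * M l) * M (l + 1) := by ring
        _ ≤ M (k + l) * M (l + 1) := by gcongr; exact (hM.pos _).le
        _ ≤ M (k + (l + 1)) * M l := by rw [← add_assoc]; linarith
    exact le_of_mul_le_mul_right h1 (hM.pos l)

/-- A weight sequence which is not geometrically bounded dominates every geometric sequence. -/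
theorem exists_mul_pow_le (hM : IsWeightSequence M) (hM' : ∀ A > 0, ∃ j, A ^ j < M j)
    {A : ℝ} (hA : 0 < A) : ∃ c > 0, ∀ j, c * A ^ j ≤ M j := by
  -- If all ratios stayed below `A`, induction would give `M j ≤ A ^ j`. Beyond `N` the increasing
  -- ratios keep `M` ahead of `A ^ j`; the constant `(max 1 A)⁻ᴺ` takes care of the first terms.
  obtain ⟨N, hN⟩ : ∃ N, A ≤ M (N + 1) / M N := by
    by_contra! h
    obtain ⟨j, hj⟩ := hM' A hA
    refine hj.not_ge ?_
    clear hj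
    induction j with
    | zero => simp [hM.zero]
    | succ j ih =>
      have := (div_lt_iff₀ (hM.pos j)).1 (h j)
      rw [pow_succ']
      exact this.le.trans (by gcongr)
  have hstep : ∀ j, N ≤ j → A * M j ≤ M (j + 1) := fun j hj =>
    (le_div_iff₀ (hM.pos j)).1 (hN.trans (hM.ratio_mono hj))
  have hB : 0 < max 1 A := by positivity
  have hmax : 1 ≤ max 1 A := le_max_left _ _
  refine ⟨((max 1 A) ^ N)⁻¹, by positivity, fun j => ?_⟩
  rw [inv_mul_le_iff₀ (by positivity)]
  induction j with
  | zero => simpa [hM.zero] using one_le_pow₀ hmax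
  | succ j ih =>
    rcases le_or_gt N j with hj | hj
    · calc A ^ (j + 1) = A * A ^ j := pow_succ' _ _
        _ ≤ A * (max 1 A ^ N * M j) := by gcongr
        _ = max 1 A ^ N * (A * M j) := by ring
        _ ≤ _ := by gcongr; exact hstep j hj
    · calc A ^ (j + 1) ≤ (max 1 A) ^ (j + 1) := by gcongr; exact le_max_right _ _
        _ ≤ (max 1 A) ^ N := pow_le_pow_right₀ hmax hj
        _ ≤ _ := le_mul_of_one_le_right (by positivity) (hM.one_le _)

end IsWeightSequence

/-! ### The Carleman ring on the interval -/

/-- The bounds `C σ^k k! M_k` defining the Carleman class. -/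
noncomputable def carlemanBound (M : ℕ → ℝ) (C σ : ℝ) (k : ℕ) : ℝ :=
  C * σ ^ k * (k.factorial : ℝ) * M k

theorem carlemanBound_mono {M : ℕ → ℝ} (hM : IsWeightSequence M) {C C' σ σ' : ℝ} (hC : 0 ≤ C)
    (hσ : 0 ≤ σ) (hCC : C ≤ C') (hσσ : σ ≤ σ') (k : ℕ) :
    carlemanBound M C σ k ≤ carlemanBound M C' σ' k := by
  unfold carlemanBound
  have := (hM.pos k).le
  have := hC.trans hCC
  gcongr

/-- Leibniz's rule: log-convexity gives `M i * M (k - i) ≤ M k`, so the `k + 1` terms share one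
bound, and `k + 1 ≤ 2 ^ k` is absorbed by doubling `σ`. -/
theorem mul_mem_boundedJets {M : ℕ → ℝ} (hM : IsWeightSequence M) {C₁ C₂ σ : ℝ} (hC₁ : 0 ≤ C₁)
    (hC₂ : 0 ≤ C₂) (hσ : 0 ≤ σ) {w₁ w₂ : ℝ → ℂ} (h₁ : w₁ ∈ boundedJets (carlemanBound M C₁ σ))
    (h₂ : w₂ ∈ boundedJets (carlemanBound M C₂ σ)) :
    w₁ * w₂ ∈ boundedJets (carlemanBound M (C₁ * C₂) (2 * σ)) := by
  refine ⟨h₁.1.mul h₂.1, fun k t ht => ?_⟩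
  rw [iteratedDeriv_mul (h₁.1.contDiffAt_symmInterval k ht) (h₂.1.contDiffAt_symmInterval k ht)]
  have hterm : ∀ i ∈ Finset.range (k + 1),
      ‖(k.choose i : ℂ) * iteratedDeriv i w₁ t * iteratedDeriv (k - i) w₂ t‖
        ≤ C₁ * C₂ * σ ^ k * (k.factorial : ℝ) * M k := by
    intro i hi
    have hik : i ≤ k := Nat.lt_succ_iff.1 (Finset.mem_range.1 hi)
    rw [norm_mul, norm_mul, Complex.norm_natCast]
    have hp := (hM.pos i).le
    have hp' := (hM.pos (k - i)).le
    have hn := (norm_nonneg _).trans (h₁.2 i t ht)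
    calc _ ≤ (k.choose i : ℝ) * carlemanBound M C₁ σ i * carlemanBound M C₂ σ (k - i) := by
          gcongr
          · exact h₁.2 i t ht
          · exact h₂.2 (k - i) t ht
      _ = C₁ * C₂ * (σ ^ i * σ ^ (k - i)) *
          ((k.choose i : ℝ) * (i.factorial : ℝ) * ((k - i).factorial : ℝ)) *
          (M i * M (k - i)) := by unfold carlemanBound; ring
      _ = C₁ * C₂ * σ ^ k * (k.factorial : ℝ) * (M i * M (k - i)) := by
          rw [← pow_add, Nat.add_sub_cancel' hik]
          congr 2
          exact_mod_cast Nat.choose_mul_factorial_mul_factorial hik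
      _ ≤ _ := by
          gcongr
          simpa [Nat.add_sub_cancel' hik] using hM.mul_le i (k - i)
  refine (norm_sum_le_of_le _ hterm).trans ?_
  rw [Finset.sum_const, Finset.card_range, nsmul_eq_mul, carlemanBound, mul_pow]
  have h2 : ((k + 1 : ℕ) : ℝ) ≤ 2 ^ k := by exact_mod_cast Nat.lt_two_pow_self
  have := (hM.pos k).le
  calc _ ≤ 2 ^ k * (C₁ * C₂ * σ ^ k * (k.factorial : ℝ) * M k) := by gcongr
    _ = _ := by ring

/-- The ring of functions on `(-1, 1)` which satisfy uniform Carleman bounds there. -/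
noncomputable def carlemanSubalgebra {M : ℕ → ℝ} (hM : IsWeightSequence M) :
    Subalgebra ℂ (ℝ → ℂ) where
  carrier := {w | ∃ C > 0, ∃ σ > 0, w ∈ boundedJets (carlemanBound M C σ)}
  mul_mem' := by
    rintro w₁ w₂ ⟨C₁, hC₁, σ₁, hσ₁, h₁⟩ ⟨C₂, hC₂, σ₂, hσ₂, h₂⟩
    refine ⟨C₁ * C₂, by positivity, 2 * max σ₁ σ₂, by positivity,
      mul_mem_boundedJets hM hC₁.le hC₂.le (by positivity)
        (boundedJets_mono (carlemanBound_mono hM hC₁.le hσ₁.le le_rfl (le_max_left _ _)) h₁)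
        (boundedJets_mono (carlemanBound_mono hM hC₂.le hσ₂.le le_rfl (le_max_right _ _)) h₂)⟩
  add_mem' := by
    rintro w₁ w₂ ⟨C₁, hC₁, σ₁, hσ₁, h₁⟩ ⟨C₂, hC₂, σ₂, hσ₂, h₂⟩
    replace h₁ := boundedJets_mono
      (carlemanBound_mono hM hC₁.le hσ₁.le le_rfl (le_max_left σ₁ σ₂)) h₁
    replace h₂ := boundedJets_mono
      (carlemanBound_mono hM hC₂.le hσ₂.le le_rfl (le_max_right σ₁ σ₂)) h₂
    refine ⟨C₁ + C₂, by positivity, max σ₁ σ₂, by positivity, h₁.1.add h₂.1, fun k t ht => ?_⟩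
    rw [iteratedDeriv_add (h₁.1.contDiffAt_symmInterval k ht)
      (h₂.1.contDiffAt_symmInterval k ht)]
    refine (norm_add_le_of_le (h₁.2 k t ht) (h₂.2 k t ht)).trans (le_of_eq ?_)
    unfold carlemanBound; ring
  algebraMap_mem' := by
    intro c
    refine ⟨‖c‖ + 1, by positivity, 1, one_pos, contDiffOn_const, fun k t _ => ?_⟩
    have hb : ∀ j, 0 ≤ carlemanBound M (‖c‖ + 1) 1 j := fun j => by
      have := (hM.pos j).le
      unfold carlemanBound; positivity
    have : (algebraMap ℂ (ℝ → ℂ)) c = fun _ => c := rfl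
    rw [this, iteratedDeriv_const]
    split_ifs with h
    · subst h; simp [carlemanBound, hM.zero]
    · simpa using hb k

theorem mem_carlemanSubalgebra {M : ℕ → ℝ} (hM : IsWeightSequence M) {w : ℝ → ℂ} :
    w ∈ carlemanSubalgebra hM ↔ ∃ C > 0, ∃ σ > 0, w ∈ boundedJets (carlemanBound M C σ) :=
  Iff.rfl

theorem contDiffOn_of_mem_carlemanSubalgebra {M : ℕ → ℝ} (hM : IsWeightSequence M) {w : ℝ → ℂ}
    (hw : w ∈ carlemanSubalgebra hM) : ContDiffOn ℝ ∞ w symmInterval :=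
  let ⟨_, _, _, _, h⟩ := hw
  h.1

/-! ### Passing between one and several variables -/

/-- The partial derivatives of a function of the last variable alone. -/
theorem iteratedFDeriv_comp_clm_apply {n : ℕ} (L : (Fin n → ℝ) →L[ℝ] ℝ) (t₀ : ℝ) {w : ℝ → ℂ}
    {s : Set ℝ} (hs : IsOpen s) (hw : ContDiffOn ℝ ∞ w s) {x : Fin n → ℝ} (hx : t₀ + L x ∈ s)
    (k : ℕ) (v : Fin k → Fin n → ℝ) :
    iteratedFDeriv ℝ k (fun y => w (t₀ + L y)) x v
      = (∏ i, L (v i)) • iteratedDeriv k w (t₀ + L x) := by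
  set s' := (fun t => t₀ + t) ⁻¹' s
  have hs' : IsOpen s' := hs.preimage (by fun_prop)
  have hw' : ContDiffOn ℝ ∞ (fun t => w (t₀ + t)) s' :=
    hw.comp (by fun_prop) (fun _ h => h)
  have hpre : IsOpen (L ⁻¹' s') := hs'.preimage L.continuous
  have h := L.iteratedFDerivWithin_comp_right hw' hs'.uniqueDiffOn hpre.uniqueDiffOn
    (x := x) hx (i := k) (by exact_mod_cast le_top)
  rw [iteratedFDerivWithin_of_isOpen k hpre hx, iteratedFDerivWithin_of_isOpen k hs' hx] at h
  have h2 := congrArg (fun T => T v) h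
  simp only [ContinuousMultilinearMap.compContinuousLinearMap_apply] at h2
  rw [iteratedFDeriv_apply_eq_iteratedDeriv_mul_prod, iteratedDeriv_comp_const_add] at h2
  exact h2

/-- A function of one variable in the Carleman class on an interval around `t₀`, seen as a function
of the last variable, belongs to the Carleman class. -/
theorem comp_last_mem_carlemanGerms {M : ℕ → ℝ} {C σ : ℝ} (hC : 0 < C)
    (hσ : 0 < σ) {w : ℝ → ℂ} (hw : w ∈ boundedJets (carlemanBound M C σ)) {t₀ : ℝ}
    (ht₀ : t₀ ∈ symmInterval) (m : ℕ) :
    (fun x : Fin (m + 1) → ℝ => w (t₀ + x (Fin.last m))) ∈ carlemanGerms (m + 1) M := by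
  set L : (Fin (m + 1) → ℝ) →L[ℝ] ℝ := ContinuousLinearMap.proj (Fin.last m) with hL
  have hLx : ∀ x, x (Fin.last m) = L x := fun x => rfl
  simp only [hLx]
  refine ⟨(fun x => t₀ + L x) ⁻¹' symmInterval, isOpen_Ioo.preimage (by fun_prop), ?_,
    hw.1.comp (by fun_prop) (fun _ h => h), C, hC, σ, hσ, fun j i x hx => ?_⟩
  · simpa using ht₀
  · rw [partialDerivative, iteratedFDeriv_comp_clm_apply L t₀ isOpen_Ioo hw.1 hx, norm_smul]
    have h1 : ‖∏ k, L (Pi.single (i k) (1 : ℝ))‖ ≤ 1 := by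
      rw [norm_prod]
      refine Finset.prod_le_one (fun _ _ => norm_nonneg _) fun k _ => ?_
      simp only [hL, ContinuousLinearMap.proj_apply, Pi.single_apply]
      split_ifs <;> simp
    calc _ ≤ 1 * ‖iteratedDeriv j w (t₀ + L x)‖ := by gcongr
      _ ≤ _ := by rw [one_mul]; exact hw.2 j _ hx

/-- Quasianalyticity propagates along the interval `(-1, 1)`. -/
theorem IsQuasianalytic.eq_zero_of_flat {M : ℕ → ℝ} (hM : IsWeightSequence M) {m : ℕ}
    (hqa : IsQuasianalytic (m + 1) M) {w : ℝ → ℂ} (hw : w ∈ carlemanSubalgebra hM)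
    (h0 : ∀ k, iteratedDeriv k w 0 = 0) {t : ℝ} (ht : t ∈ symmInterval) : w t = 0 := by
  obtain ⟨C, hC, σ, hσ, hw⟩ := hw
  -- Translating by `t₀` turns flatness at `t₀` into flatness at the origin of a germ depending on
  -- the last variable only.
  have hlocal : ∀ t₀ ∈ symmInterval, (∀ k, iteratedDeriv k w t₀ = 0) → w =ᶠ[𝓝 t₀] 0 := by
    intro t₀ ht₀ hflat
    have h := hqa _ (comp_last_mem_carlemanGerms hC hσ hw ht₀ m) (fun j i => by
      have := iteratedFDeriv_comp_clm_apply
        (ContinuousLinearMap.proj (Fin.last m) : (Fin (m + 1) → ℝ) →L[ℝ] ℝ) t₀ isOpen_Ioo hw.1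
        (x := 0) (by simpa using ht₀) j (fun k => Pi.single (i k) (1 : ℝ))
      simp only [map_zero, add_zero, hflat, smul_zero] at this
      exact this)
    have hlim : Tendsto (fun t : ℝ => (fun _ : Fin (m + 1) => t - t₀)) (𝓝 t₀) (𝓝 0) := by
      rw [tendsto_pi_nhds]
      intro _
      have : Tendsto (fun y : ℝ => y - t₀) (𝓝 t₀) (𝓝 (t₀ - t₀)) :=
        (continuous_id.sub continuous_const).tendsto t₀
      simpa using this
    filter_upwards [hlim.eventually h] with t ht
    simpa using ht
  set Z : Set ℝ := {t | w =ᶠ[𝓝 t] 0} with hZ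
  have hZo : IsOpen Z := by
    rw [isOpen_iff_mem_nhds]
    intro t ht
    exact eventually_eventually_nhds.2 ht
  -- Connectedness: at a limit point of `Z` in the interval all derivatives vanish by continuity, so
  -- the local statement applies again.
  have hsub : symmInterval ⊆ Z := by
    refine isPreconnected_Ioo.subset_of_closure_inter_subset hZo
      ⟨0, by simp, hlocal 0 (by simp) h0⟩ ?_
    rintro t ⟨htc, ht⟩
    refine hlocal t ht fun k => ?_
    have hcont : ContinuousAt (iteratedDeriv k w) t :=
      (hw.1.hasDerivAt_iteratedDeriv isOpen_Ioo k ht).continuousAt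
    have hz : ∀ y ∈ Z, iteratedDeriv k w y ∈ ({0} : Set ℂ) := by
      intro y hy
      have := Filter.EventuallyEq.iteratedDeriv_eq k hy
      simpa [Pi.zero_def] using this
    have := hcont.continuousWithinAt.mem_closure htc hz
    simpa using this
  exact (hsub ht).self_of_nhds

/-- A bound for all partial derivatives of order `k` bounds the derivative as a multilinear map. -/
theorem norm_iteratedFDeriv_apply_le {n : ℕ} {f : (Fin n → ℝ) → ℂ} {k : ℕ} {x : Fin n → ℝ} {D : ℝ}
    (h : ∀ i : Fin k → Fin n, ‖partialDerivative i f x‖ ≤ D) (v : Fin k → Fin n → ℝ) :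
    ‖iteratedFDeriv ℝ k f x v‖ ≤ (∏ l, ∑ i, |v l i|) * D := by
  have hv : v = fun l => ∑ i, v l i • Pi.single i (1 : ℝ) := by
    ext l j
    simp [Finset.sum_apply, Pi.single_apply]
  conv_lhs => rw [hv]
  rw [ContinuousMultilinearMap.map_sum]
  simp only [ContinuousMultilinearMap.map_smul_univ]
  refine (norm_sum_le _ _).trans ?_
  rw [Finset.prod_univ_sum, Fintype.piFinset_univ, Finset.sum_mul]
  refine Finset.sum_le_sum fun r _ => ?_
  rw [norm_smul, norm_prod]
  simp only [Real.norm_eq_abs]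
  gcongr
  exact h r

theorem hasDerivAt_iteratedFDeriv_line {n : ℕ} {f : (Fin n → ℝ) → ℂ} {U : Set (Fin n → ℝ)}
    (hU : IsOpen U) (hf : ContDiffOn ℝ ∞ f U) {p v : Fin n → ℝ} {t : ℝ} (ht : p + t • v ∈ U)
    (k : ℕ) :
    HasDerivAt (fun s : ℝ => iteratedFDeriv ℝ k f (p + s • v) fun _ => v)
      (iteratedFDeriv ℝ (k + 1) f (p + t • v) fun _ => v) t := by
  have h1 : HasFDerivAt (iteratedFDeriv ℝ k f) (fderiv ℝ (iteratedFDeriv ℝ k f) (p + t • v))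
      (p + t • v) :=
    ((hf.contDiffAt (hU.mem_nhds ht)).differentiableAt_iteratedFDeriv
      (by exact_mod_cast ENat.natCast_lt_top k)).hasFDerivAt
  have h2 : HasDerivAt (fun s : ℝ => p + s • v) v t := by
    simpa using ((hasDerivAt_id t).smul_const v).const_add p
  have h3 := h1.comp_hasDerivAt t h2
  have h4 := ((ContinuousMultilinearMap.apply ℝ (fun _ : Fin k => Fin n → ℝ) ℂ
    (fun _ => v)).hasFDerivAt).comp_hasDerivAt t h3
  rw [iteratedFDeriv_succ_apply_left]
  exact h4

/-- Expanding a derivative along `v` in coordinate directions costs `(∑ |v i|) ^ k ≤ 1`, so the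
constants do not change. -/
theorem line_mem_boundedJets {M : ℕ → ℝ} (hM : IsWeightSequence M) {n : ℕ} {f : (Fin n → ℝ) → ℂ}
    {U : Set (Fin n → ℝ)} (hU : IsOpen U) (hf : ContDiffOn ℝ ∞ f U) {C σ : ℝ}
    (hC : 0 ≤ C) (hσ : 0 ≤ σ) (hb : ∀ (j : ℕ) (i : Fin j → Fin n), ∀ x ∈ U,
      ‖partialDerivative i f x‖ ≤ C * σ ^ j * (j.factorial : ℝ) * M j)
    {p v : Fin n → ℝ} (hp : ∀ t ∈ symmInterval, p + t • v ∈ U) (hv : ∑ i, |v i| ≤ 1) :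
    (fun t : ℝ => f (p + t • v)) ∈ boundedJets (carlemanBound M C σ) := by
  have h := mem_boundedJets_of_chain (B := carlemanBound M C σ)
    (u := fun k (s : ℝ) => iteratedFDeriv ℝ k f (p + s • v) fun _ => v)
    (fun k t ht => hasDerivAt_iteratedFDeriv_line hU hf (hp t ht) k)
    (fun k t ht => by
      have hb' := fun i => hb k i _ (hp t ht)
      refine (norm_iteratedFDeriv_apply_le hb' _).trans ?_
      rw [Finset.prod_const, carlemanBound]
      have hD : 0 ≤ C * σ ^ k * (k.factorial : ℝ) * M k := by
        have := (hM.pos k).le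
        positivity
      have hS : 0 ≤ ∑ i, |v i| := Finset.sum_nonneg fun _ _ => abs_nonneg _
      exact mul_le_of_le_one_left hD (pow_le_one₀ hS hv))
  simpa using h

/-! ### Formal uniqueness of division -/

/-- A polynomial of degree less than `d` which is `O(x^d)` at the origin vanishes. -/
theorem coeff_eq_zero_of_norm_le_pow {d : ℕ} (b : Fin d → ℂ) {G r : ℝ} (hr : 0 < r)
    (h : ∀ x ∈ Set.Ioo 0 r, ‖∑ j, b j * (x : ℂ) ^ (j : ℕ)‖ ≤ G * x ^ d) (j : Fin d) : b j = 0 := by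
  induction d with
  | zero => exact j.elim0
  | succ d ih =>
    have h0 : b 0 = 0 := by
      have hne : (𝓝[>] (0 : ℝ)).NeBot := inferInstance
      have hmem : Set.Ioo 0 r ∈ 𝓝[>] (0 : ℝ) := Ioo_mem_nhdsGT hr
      have hl : Tendsto (fun x : ℝ => ‖∑ j : Fin (d + 1), b j * (x : ℂ) ^ (j : ℕ)‖) (𝓝[>] 0)
          (𝓝 ‖∑ j : Fin (d + 1), b j * ((0 : ℝ) : ℂ) ^ (j : ℕ)‖) := by
        refine Tendsto.mono_left ?_ nhdsWithin_le_nhds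
        exact Continuous.tendsto (by fun_prop) 0
      have hr' : Tendsto (fun x : ℝ => G * x ^ (d + 1)) (𝓝[>] 0) (𝓝 (G * 0 ^ (d + 1))) := by
        refine Tendsto.mono_left ?_ nhdsWithin_le_nhds
        exact Continuous.tendsto (by fun_prop) 0
      have := le_of_tendsto_of_tendsto hl hr' (Filter.mem_of_superset hmem h)
      simpa [Fin.sum_univ_succ] using this
    refine Fin.cases h0 (fun i => ?_) j
    refine ih (fun i => b i.succ) (fun x hx => ?_) i
    have h1 := h x hx
    have h2 : ∑ j : Fin (d + 1), b j * (x : ℂ) ^ (j : ℕ)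
        = x * ∑ i : Fin d, b i.succ * (x : ℂ) ^ (i : ℕ) := by
      rw [Fin.sum_univ_succ, h0, Finset.mul_sum]
      simp [pow_succ', mul_left_comm]
    rw [h2, norm_mul, Complex.norm_real, Real.norm_of_nonneg hx.1.le] at h1
    refine le_of_mul_le_mul_left (h1.trans (le_of_eq ?_)) hx.1
    ring

/-- Uniqueness of Weierstrass division at the level of Taylor expansions in the parameter `t`. -/
theorem iteratedDeriv_eq_zero_of_division {d : ℕ} {φ γ : ℝ → ℝ → ℂ} {η : Fin d → ℝ → ℂ} {r : ℝ}
    (hr : 0 < r) (hφ : ∀ x ∈ Set.Ioo 0 r, ContDiffOn ℝ ∞ (φ x) symmInterval)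
    (hφ0 : ∀ x ∈ Set.Ioo 0 r, φ x 0 = (x : ℂ) ^ d)
    (hγ : ∀ x ∈ Set.Ioo 0 r, ContDiffOn ℝ ∞ (γ x) symmInterval)
    (hγb : ∀ k, ∃ G, ∀ x ∈ Set.Ioo 0 r, ‖iteratedDeriv k (γ x) 0‖ ≤ G)
    (hη : ∀ j, ContDiffOn ℝ ∞ (η j) symmInterval)
    (h : ∀ x ∈ Set.Ioo 0 r, ∀ t ∈ symmInterval,
      φ x t * γ x t + ∑ j, η j t * (x : ℂ) ^ (j : ℕ) = 0) (k : ℕ) (j : Fin d) :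
    iteratedDeriv k (η j) 0 = 0 := by
  have h0 : (0 : ℝ) ∈ symmInterval := by simp
  -- The quotient must be carried through the induction: when its lower derivatives vanish,
  -- Leibniz's rule leaves only `φ x 0 = x ^ d` times its derivative of order `k`. Boundedness of
  -- the latter makes the remainder `O(x ^ d)`.
  suffices H : ∀ k, (∀ j, iteratedDeriv k (η j) 0 = 0) ∧
      ∀ x ∈ Set.Ioo 0 r, iteratedDeriv k (γ x) 0 = 0 from (H k).1 j
  intro k
  induction k using Nat.strong_induction_on with
  | _ k ih =>
    have key : ∀ x ∈ Set.Ioo 0 r, (x : ℂ) ^ d * iteratedDeriv k (γ x) 0 +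
        ∑ j, iteratedDeriv k (η j) 0 * (x : ℂ) ^ (j : ℕ) = 0 := by
      intro x hx
      have hz : (fun t => φ x t * γ x t + ∑ j, η j t * (x : ℂ) ^ (j : ℕ)) =ᶠ[𝓝 0] fun _ => 0 :=
        Filter.mem_of_superset (isOpen_Ioo.mem_nhds h0) (h x hx)
      have h1 := hz.iteratedDeriv_eq k
      have hφ' := (hφ x hx).contDiffAt_symmInterval k h0
      have hγ' := (hγ x hx).contDiffAt_symmInterval k h0
      have hη' := fun j => (hη j).contDiffAt_symmInterval k h0
      rw [iteratedDeriv_fun_add (hφ'.mul hγ')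
        (ContDiffAt.sum fun j _ => (hη' j).mul contDiffAt_const),
        iteratedDeriv_fun_mul hφ' hγ',
        iteratedDeriv_fun_sum fun j _ => (hη' j).mul contDiffAt_const,
        Finset.sum_eq_single_of_mem 0 (by simp)] at h1
      · simp only [Nat.choose_zero_right, Nat.cast_one, one_mul, iteratedDeriv_zero, hφ0 x hx,
          Nat.sub_zero] at h1
        have h2 : ∀ j : Fin d, iteratedDeriv k (fun t => η j t * (x : ℂ) ^ (j : ℕ)) 0
            = iteratedDeriv k (η j) 0 * (x : ℂ) ^ (j : ℕ) := fun j => by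
          simp only [mul_comm _ ((x : ℂ) ^ (j : ℕ))]
          rw [iteratedDeriv_const_mul _ (hη' j)]
        simp only [h2] at h1
        rw [h1]
        simp
      · intro l hl hl0
        rw [(ih (k - l) (by have := Finset.mem_range.1 hl; omega)).2 x hx, mul_zero]
    obtain ⟨G, hG⟩ := hγb k
    have hη0 : ∀ j, iteratedDeriv k (η j) 0 = 0 := by
      refine coeff_eq_zero_of_norm_le_pow _ (G := G) hr fun x hx => ?_
      rw [eq_neg_of_add_eq_zero_right (key x hx), norm_neg, norm_mul, norm_pow, Complex.norm_real,
        Real.norm_of_nonneg hx.1.le, mul_comm]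
      have := hx.1.le
      gcongr
      exact hG x hx
    refine ⟨hη0, fun x hx => ?_⟩
    have h1 := key x hx
    simp only [hη0, zero_mul, Finset.sum_const_zero, add_zero] at h1
    exact (mul_eq_zero.1 h1).resolve_left (pow_ne_zero _ (by exact_mod_cast hx.1.ne'))

/-! ### Analyticity under geometric growth -/

/-- If `M` is geometrically bounded, then the germs in the Carleman class are real-analytic. -/
theorem carlemanGerms_subset_analyticGerms {M : ℕ → ℝ} (hM : IsWeightSequence M) {A : ℝ}
    (hA : 0 < A) (hMA : ∀ j, M j ≤ A ^ j) (n : ℕ) : carlemanGerms n M ⊆ analyticGerms n := by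
  rintro f ⟨U, hU, h0U, hf, C, hC, σ, hσ, hb⟩
  obtain ⟨r₀, hr₀, hrU⟩ := Metric.isOpen_iff.1 hU 0 h0U
  -- Coordinate sums are at most `n * ‖v‖`; `n + 1` keeps `κ` positive when `n = 0`.
  set κ : ℝ := (n + 1) * (σ * A) with hκ
  have hκ0 : 0 < κ := by positivity
  have hderiv : ∀ k, ∀ x ∈ U, ∀ v : Fin k → Fin n → ℝ,
      ‖iteratedFDeriv ℝ k f x v‖ ≤ C * k.factorial * κ ^ k * ∏ l, ‖v l‖ := by
    intro k x hx v
    refine (norm_iteratedFDeriv_apply_le (fun i => hb k i x hx) v).trans ?_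
    have h1 : ∏ l, ∑ i, |v l i| ≤ ∏ l, ((n + 1 : ℝ) * ‖v l‖) := by
      refine Finset.prod_le_prod (fun _ _ => Finset.sum_nonneg fun _ _ => abs_nonneg _)
        fun l _ => ?_
      refine (Finset.sum_le_card_nsmul _ _ ‖v l‖ fun i _ => norm_le_pi_norm (v l) i).trans ?_
      simp only [Finset.card_univ, Fintype.card_fin, nsmul_eq_mul]
      gcongr
      linarith
    rw [Finset.prod_mul_distrib, Finset.prod_const, Finset.card_univ, Fintype.card_fin] at h1
    have := (hM.pos k).le
    calc _ ≤ ((n + 1 : ℝ) ^ k * ∏ l, ‖v l‖) * (C * σ ^ k * (k.factorial : ℝ) * A ^ k) := by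
          gcongr
          exact hMA k
      _ = _ := by rw [hκ, mul_pow, mul_pow]; ring
  clear_value κ
  set p : FormalMultilinearSeries ℝ (Fin n → ℝ) ℂ :=
    fun k => ((k.factorial : ℝ)⁻¹) • iteratedFDeriv ℝ k f 0 with hp
  have hpk : ∀ k (y : Fin n → ℝ), ‖p k fun _ => y‖ ≤ C * (κ * ‖y‖) ^ k := by
    intro k y
    have := hderiv k 0 h0U fun _ => y
    simp only [hp, smul_apply, norm_smul, norm_inv, Real.norm_natCast]
    rw [inv_mul_le_iff₀ (by positivity)]
    refine this.trans (le_of_eq ?_)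
    simp only [Finset.prod_const, Finset.card_univ, Fintype.card_fin, mul_pow]
    ring
  set r : ℝ := min (r₀ / 2) (1 / (2 * κ)) with hr
  have hr0 : 0 < r := by positivity
  have hκr : κ * r ≤ 1 / 2 := by
    calc κ * r ≤ κ * (1 / (2 * κ)) := by gcongr; exact min_le_right _ _
      _ = 1 / 2 := by field_simp
  refine ⟨p, ENNReal.ofReal r, ?_, by simpa using hr0, ?_⟩
  · refine p.le_radius_of_bound C (r := r.toNNReal) fun k => ?_
    have hn : ‖p k‖ ≤ C * κ ^ k := by
      refine ContinuousMultilinearMap.opNorm_le_bound (by positivity) fun v => ?_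
      have := hderiv k 0 h0U v
      simp only [hp, smul_apply, norm_smul, norm_inv, Real.norm_natCast]
      rw [inv_mul_le_iff₀ (by positivity)]
      exact this.trans (le_of_eq (by ring))
    rw [Real.coe_toNNReal _ hr0.le]
    calc ‖p k‖ * r ^ k ≤ C * κ ^ k * r ^ k := by gcongr
      _ = C * (κ * r) ^ k := by rw [mul_pow]; ring
      _ ≤ C * 1 := by gcongr; exact pow_le_one₀ (by positivity) (by linarith)
      _ = C := mul_one C
  · intro y hy
    rw [Metric.eball_ofReal, mem_ball_zero_iff] at hy
    have hκy : κ * ‖y‖ ≤ 1 / 2 := by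
      refine le_trans ?_ hκr
      gcongr
    have hsummable : Summable fun k => ‖p k fun _ => y‖ :=
      Summable.of_nonneg_of_le (fun _ => norm_nonneg _) (fun k => hpk k y)
        ((summable_geometric_of_lt_one (by positivity) (by linarith)).mul_left C)
    rw [zero_add, hasSum_iff_tendsto_nat_of_summable_norm hsummable,
      ← tendsto_add_atTop_iff_nat 1]
    set w : ℝ → ℂ := fun t => f (t • y) with hw
    set s : Set ℝ := (fun t : ℝ => t • y) ⁻¹' U with hs
    have hso : IsOpen s := hU.preimage (by fun_prop)
    have hIs : Set.Icc (0 : ℝ) 1 ⊆ s := by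
      intro t ht
      refine hrU ?_
      rw [mem_ball_zero_iff, norm_smul, Real.norm_of_nonneg ht.1]
      calc t * ‖y‖ ≤ 1 * ‖y‖ := by gcongr; exact ht.2
        _ < r₀ := by
          have : r ≤ r₀ / 2 := min_le_left _ _
          linarith
    have hchain : ∀ k, ∀ t ∈ s, HasDerivAt
        (fun t : ℝ => iteratedFDeriv ℝ k f (0 + t • y) fun _ => y)
        (iteratedFDeriv ℝ (k + 1) f (0 + t • y) fun _ => y) t := fun k t ht =>
      hasDerivAt_iteratedFDeriv_line hU hf (by simpa [hs] using ht) k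
    have hw0 : (fun t : ℝ => iteratedFDeriv ℝ 0 f (0 + t • y) fun _ => y) = w := by
      ext t; simp [hw]
    have hws : ContDiffOn ℝ ∞ w s := hw0 ▸ contDiffOn_of_chain hso hchain
    have hwd : ∀ k, ∀ t ∈ Set.Icc (0 : ℝ) 1, iteratedDerivWithin k w (Set.Icc 0 1) t
        = iteratedFDeriv ℝ k f (t • y) fun _ => y := by
      intro k t ht
      rw [iteratedDerivWithin_eq_iteratedDeriv (uniqueDiffOn_Icc one_pos)
        ((hws.contDiffAt (hso.mem_nhds (hIs ht))).of_le (by exact_mod_cast le_top)) ht]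
      have := iteratedDeriv_eqOn_of_chain hso hchain k (hIs ht)
      rw [hw0] at this
      simpa using this
    -- Taylor's bound divides `(k + 1)!` by `k!`; the leftover factor `k + 1` is harmless against
    -- `(1 / 2) ^ (k + 1)`, which comes from `κ * ‖y‖ ≤ 1 / 2`.
    have hrem : ∀ k : ℕ, ‖f y - ∑ i ∈ Finset.range (k + 1), p i fun _ => y‖
        ≤ C * ((k + 1 : ℕ) * (1 / 2 : ℝ) ^ (k + 1)) := by
      intro k
      have h1 := taylor_mean_remainder_bound (f := w) (n := k) (x := 1)
        (C := C * (k + 1).factorial * (1 / 2) ^ (k + 1)) zero_le_one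
        ((hws.mono hIs).of_le (by exact_mod_cast le_top)) (by simp) (fun t ht => by
          rw [hwd _ t ht]
          refine (hderiv _ _ (hIs ht) _).trans ?_
          simp only [Finset.prod_const, Finset.card_univ, Fintype.card_fin]
          rw [mul_assoc, ← mul_pow]
          gcongr)
      rw [taylor_within_apply] at h1
      have h2 : ∀ i, (((i.factorial : ℝ)⁻¹ * (1 - 0 : ℝ) ^ i) •
          iteratedDerivWithin i w (Set.Icc 0 1) 0) = p i fun _ => y := by
        intro i
        rw [hwd i 0 (by simp)]
        simp [hp]
      simp only [h2] at h1
      simp only [hw, one_smul, sub_zero, one_pow, mul_one] at h1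
      refine h1.trans (le_of_eq ?_)
      rw [Nat.factorial_succ]
      push_cast
      field_simp
    have hlim : Tendsto (fun k : ℕ => C * ((k + 1 : ℕ) * (1 / 2 : ℝ) ^ (k + 1))) atTop (𝓝 0) := by
      have := (tendsto_self_mul_const_pow_of_lt_one (r := (1 / 2 : ℝ)) (by norm_num)
        (by norm_num)).const_mul C
      rw [mul_zero] at this
      exact (tendsto_add_atTop_iff_nat 1).2 this
    rw [tendsto_iff_norm_sub_tendsto_zero]
    refine squeeze_zero (fun _ => norm_nonneg _) (fun k => ?_) hlim
    rw [norm_sub_rev]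
    exact hrem k

/-- The strict inclusion enters here: it rules out a geometric bound on `M`. -/
theorem exists_mul_pow_le_of_analyticGerms_ssubset {M : ℕ → ℝ} (hM : IsWeightSequence M) {n : ℕ}
    (hstrict : analyticGerms n ⊂ carlemanGerms n M) {A : ℝ} (hA : 0 < A) :
    ∃ c > 0, ∀ j, c * A ^ j ≤ M j := by
  refine hM.exists_mul_pow_le (fun B hB => ?_) hA
  by_contra! h
  exact hstrict.2 (carlemanGerms_subset_analyticGerms hM hB h n)

/-! ### The Banach space for the Baire argument -/

/-- The polynomials whose derivatives on `(-1, 1)` satisfy the Carleman bounds with constants `1`. -/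
def unitPolynomials (M : ℕ → ℝ) : Set (Polynomial ℂ) :=
  {P | ∀ k, ∀ t ∈ symmInterval,
    ‖(Polynomial.derivative^[k] P).eval (t : ℂ)‖ ≤ carlemanBound M 1 1 k}

/-- The Banach space of absolutely summable families of coefficients. -/
abbrev PolynomialSeries (M : ℕ → ℝ) : Type := lp (fun _ : unitPolynomials M => ℂ) 1

namespace PolynomialSeries

variable {M : ℕ → ℝ}

/-- The sum of the series of derivatives of order `k`. -/
noncomputable def derivSum (c : PolynomialSeries M) (k : ℕ) (t : ℝ) : ℂ :=
  ∑' P : unitPolynomials M, c P * (Polynomial.derivative^[k] P.1).eval (t : ℂ)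

theorem summable_norm (c : PolynomialSeries M) : Summable fun P => ‖c P‖ := by
  simpa using (lp.memℓp c).summable (by simp)

theorem tsum_norm (c : PolynomialSeries M) : ∑' P, ‖c P‖ = ‖c‖ := by
  rw [lp.norm_eq_tsum_rpow (by simp)]
  simp

theorem norm_term_le (c : PolynomialSeries M) (k : ℕ) {t : ℝ} (ht : t ∈ symmInterval)
    (P : unitPolynomials M) :
    ‖c P * (Polynomial.derivative^[k] P.1).eval (t : ℂ)‖ ≤ ‖c P‖ * carlemanBound M 1 1 k := by
  rw [norm_mul]
  gcongr
  exact P.2 k t ht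

theorem summable_term (c : PolynomialSeries M) (k : ℕ) {t : ℝ} (ht : t ∈ symmInterval) :
    Summable fun P : unitPolynomials M => c P * (Polynomial.derivative^[k] P.1).eval (t : ℂ) :=
  Summable.of_norm_bounded (c.summable_norm.mul_right _) (c.norm_term_le k ht)

theorem norm_derivSum_le (c : PolynomialSeries M) (k : ℕ) {t : ℝ} (ht : t ∈ symmInterval) :
    ‖c.derivSum k t‖ ≤ ‖c‖ * carlemanBound M 1 1 k := by
  rw [← c.tsum_norm, ← tsum_mul_right]
  exact tsum_of_norm_bounded (c.summable_norm.mul_right _).hasSum (c.norm_term_le k ht)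

theorem hasDerivAt_derivSum (c : PolynomialSeries M) (k : ℕ) {t : ℝ} (ht : t ∈ symmInterval) :
    HasDerivAt (c.derivSum k) (c.derivSum (k + 1) t) t := by
  refine hasDerivAt_tsum_of_isPreconnected (c.summable_norm.mul_right (carlemanBound M 1 1 (k + 1)))
    isOpen_Ioo isPreconnected_Ioo (fun P y _ => ?_) (fun P y hy => c.norm_term_le (k + 1) hy P) ht
    (c.summable_term k ht) ht
  rw [Function.iterate_succ_apply']
  exact (((Polynomial.derivative^[k] P.1).hasDerivAt (y : ℂ)).comp_ofReal).const_mul (c P)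

theorem derivSum_mem_boundedJets (c : PolynomialSeries M) :
    c.derivSum 0 ∈ boundedJets (carlemanBound M ‖c‖ 1) :=
  mem_boundedJets_of_chain (u := c.derivSum) (fun k _ ht => c.hasDerivAt_derivSum k ht)
    fun k _ ht => (c.norm_derivSum_le k ht).trans_eq (by unfold carlemanBound; ring)

theorem derivSum_sub (c c' : PolynomialSeries M) (k : ℕ) {t : ℝ} (ht : t ∈ symmInterval) :
    (c - c').derivSum k t = c.derivSum k t - c'.derivSum k t := by
  unfold derivSum
  rw [← (c.summable_term k ht).tsum_sub (c'.summable_term k ht)]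
  simp [sub_mul]

theorem continuous_derivSum (k : ℕ) {t : ℝ} (ht : t ∈ symmInterval) :
    Continuous fun c : PolynomialSeries M => c.derivSum k t := by
  rw [continuous_iff_continuousAt]
  intro c
  rw [ContinuousAt, tendsto_iff_norm_sub_tendsto_zero]
  have h : Tendsto (fun c' : PolynomialSeries M => ‖c' - c‖ * carlemanBound M 1 1 k) (𝓝 c)
      (𝓝 (‖c - c‖ * carlemanBound M 1 1 k)) := Continuous.tendsto (by fun_prop) c
  rw [sub_self, norm_zero, zero_mul] at h
  refine squeeze_zero (fun _ => norm_nonneg _) (fun c' => ?_) h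
  rw [← derivSum_sub _ _ _ ht]
  exact norm_derivSum_le _ _ ht

open Classical in
theorem derivSum_single (P : unitPolynomials M) (b : ℂ) (t : ℝ) :
    derivSum (lp.single 1 P b : PolynomialSeries M) 0 t = b * P.1.eval (t : ℂ) := by
  unfold derivSum
  rw [tsum_eq_single P]
  · simp
  · intro Q hQ
    rw [lp.single_apply_ne _ _ _ hQ, zero_mul]

end PolynomialSeries

/-! ### Division along lines, with uniform bounds -/

/-- Division by the polynomial with coefficients `a` along the line `t ↦ t v`, with quotient `γ`,
remainder `h`, and derivatives in `t` bounded by `B`. -/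
structure LineDivision {m d : ℕ} (a : Fin d → ((Fin m → ℝ) → ℂ)) (v : Fin m → ℝ) (B : ℕ → ℝ)
    (r : ℝ) (F : ℝ → ℂ) (h : Fin d → ℝ → ℂ) (γ : ℝ → ℝ → ℂ) : Prop where
  remainder_mem : ∀ j, h j ∈ boundedJets B
  quotient_mem : ∀ x ∈ Set.Ioo 0 r, γ x ∈ boundedJets B
  eq : ∀ x ∈ Set.Ioo 0 r, ∀ t ∈ symmInterval,
    F x = monicPoly a (t • v) x * γ x t + ∑ j, h j t * (x : ℂ) ^ (j : ℕ)

/-- The series which can be divided along all short lines, with bounds given by `N`. -/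
def divisibleSeries (M : ℕ → ℝ) {m d : ℕ} (a : Fin d → ((Fin m → ℝ) → ℂ)) (N : ℕ) :
    Set (PolynomialSeries M) :=
  {c | ∀ v : Fin m → ℝ, ‖v‖ < 1 / ((N : ℝ) + 1) → ∃ h γ,
    LineDivision a v (carlemanBound M (N + 1) (N + 1)) (1 / ((N : ℝ) + 1)) (c.derivSum 0) h γ}

/-- Quotients and remainders for a convergent sequence of series obey common bounds, so they have
limits along an ultrafilter. The dividing identity is pointwise and passes to the limit; no
regularity of the quotient in `x` is required. -/
theorem isClosed_divisibleSeries (M : ℕ → ℝ) {m d : ℕ} (a : Fin d → ((Fin m → ℝ) → ℂ)) (N : ℕ) :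
    IsClosed (divisibleSeries M a N) := by
  refine IsSeqClosed.isClosed fun c c' hc hlim v hv => ?_
  choose h γ hdiv using fun n => hc n v hv
  set l : Ultrafilter ℕ := hyperfilter ℕ
  choose h' hh' hh'l using fun j =>
    exists_tendsto_mem_boundedJets l fun n => (hdiv n).remainder_mem j
  have hγ : ∀ x, ∃ γ' : ℝ → ℂ, x ∈ Set.Ioo 0 (1 / ((N : ℝ) + 1)) →
      γ' ∈ boundedJets (carlemanBound M (N + 1) (N + 1)) ∧
      ∀ t ∈ symmInterval, Tendsto (fun n => γ n x t) l (𝓝 (γ' t)) := by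
    intro x
    by_cases hx : x ∈ Set.Ioo 0 (1 / ((N : ℝ) + 1))
    · obtain ⟨γ', h1, h2⟩ :=
        exists_tendsto_mem_boundedJets l fun n => (hdiv n).quotient_mem x hx
      exact ⟨γ', fun _ => ⟨h1, h2⟩⟩
    · exact ⟨0, fun h => absurd h hx⟩
  choose γ' hγ' using hγ
  refine ⟨h', γ', hh', fun x hx => (hγ' x hx).1, fun x hx t ht => ?_⟩
  have hxI : x ∈ symmInterval := by
    refine ⟨by linarith [hx.1], hx.2.trans_le ?_⟩
    rw [div_le_one (by positivity)]
    linarith [N.cast_nonneg (α := ℝ)]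
  have h1 : Tendsto (fun n => (c n).derivSum 0 x) l (𝓝 (c'.derivSum 0 x)) :=
    (((PolynomialSeries.continuous_derivSum 0 hxI).tendsto c').comp hlim).mono_left
      Nat.hyperfilter_le_atTop
  refine tendsto_nhds_unique h1 ?_
  have h2 : ∀ n, (c n).derivSum 0 x = _ := fun n => (hdiv n).eq x hx t ht
  simp only [h2]
  exact (((hγ' x hx).2 t ht).const_mul _).add
    (tendsto_finsetSum _ fun j _ => (hh'l j t ht).mul_const _)

/-- One integer plays every role: it exceeds `C`, `σ`, the inverse radius of a ball in the domain,
and the dimension, the last so that short directions satisfy `∑ |v i| ≤ 1`. -/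
theorem eventually_line_mem_boundedJets {M : ℕ → ℝ} (hM : IsWeightSequence M) {n : ℕ}
    {f : (Fin n → ℝ) → ℂ} (hf : f ∈ carlemanGerms n M) :
    ∀ᶠ N : ℕ in atTop, ∀ p v : Fin n → ℝ,
      (∀ t ∈ symmInterval, ‖p + t • v‖ < 1 / ((N : ℝ) + 1)) → ‖v‖ < 1 / ((N : ℝ) + 1) →
      (fun t : ℝ => f (p + t • v)) ∈ boundedJets (carlemanBound M (N + 1) (N + 1)) := by
  obtain ⟨U, hU, h0U, hf, C, hC, σ, hσ, hb⟩ := hf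
  obtain ⟨r, hr, hrU⟩ := Metric.isOpen_iff.1 hU 0 h0U
  have hN : Tendsto (fun N : ℕ => (N : ℝ)) atTop atTop := tendsto_natCast_atTop_atTop
  filter_upwards [hN.eventually_ge_atTop C, hN.eventually_ge_atTop σ,
    hN.eventually_ge_atTop (1 / r), hN.eventually_ge_atTop (n : ℝ)] with N h1 h2 h3 h4 p v hp hv
  have hNr : 1 / ((N : ℝ) + 1) ≤ r := by
    rw [div_le_iff₀ (by positivity)]
    rw [div_le_iff₀ hr] at h3
    linarith
  refine boundedJets_mono (carlemanBound_mono hM hC.le hσ.le (by linarith) (by linarith))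
    (line_mem_boundedJets hM hU hf hC.le hσ.le hb
      (fun t ht => hrU (by simpa using (hp t ht).trans_le hNr)) ?_)
  calc ∑ i, |v i| ≤ ∑ _i : Fin n, ‖v‖ := Finset.sum_le_sum fun i _ => norm_le_pi_norm v i
    _ = n * ‖v‖ := by simp
    _ ≤ n * (1 / ((N : ℝ) + 1)) := by gcongr
    _ ≤ 1 := by
      rw [mul_one_div, div_le_one (by positivity)]
      linarith

/-- Shows that the closed sets cover the Banach space: a division of germs is restricted to lines
parallel to `(v, 0)`, with the last coordinate frozen at `x`. -/
theorem eventually_mem_divisibleSeries {M : ℕ → ℝ} (hM : IsWeightSequence M) {m d : ℕ}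
    {a : Fin d → ((Fin m → ℝ) → ℂ)} (hdiv : WeierstrassDivisionHolds M d (monicPolyGerm a))
    (c : PolynomialSeries M) : ∀ᶠ N : ℕ in atTop, c ∈ divisibleSeries M a N := by
  obtain ⟨g, hg, h, hh, heq⟩ := hdiv _ (comp_last_mem_carlemanGerms (C := ‖c‖ + 1) (σ := 1)
    (w := c.derivSum 0) (by positivity) one_pos
    (boundedJets_mono (carlemanBound_mono hM (norm_nonneg _) zero_le_one (by linarith) le_rfl)
      c.derivSum_mem_boundedJets) (t₀ := 0) (by simp) m)
  obtain ⟨ε, hε, hεeq⟩ := Metric.eventually_nhds_iff_ball.1 heq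
  have hN : Tendsto (fun N : ℕ => 1 / ((N : ℝ) + 1)) atTop (𝓝 0) :=
    tendsto_one_div_add_atTop_nhds_zero_nat
  filter_upwards [eventually_line_mem_boundedJets hM hg,
    eventually_all.2 fun j => eventually_line_mem_boundedJets hM (hh j),
    hN.eventually_lt_const hε] with N hNg hNh hNε v hv
  have hpt : ∀ x t : ℝ, (Fin.snoc (α := fun _ => ℝ) 0 x : Fin (m + 1) → ℝ) +
      t • (Fin.snoc (α := fun _ => ℝ) v 0 : Fin (m + 1) → ℝ)
        = Fin.snoc (α := fun _ => ℝ) (t • v) x := by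
    intro x t
    ext i
    refine Fin.lastCases ?_ (fun i => ?_) i <;> simp
  have htv : ∀ t ∈ symmInterval, ‖t • v‖ < 1 / ((N : ℝ) + 1) := by
    intro t ht
    refine lt_of_le_of_lt ?_ hv
    rw [norm_smul]
    exact mul_le_of_le_one_left (norm_nonneg _) (abs_le.2 ⟨ht.1.le, ht.2.le⟩)
  have hsnoc : ∀ {y : Fin m → ℝ} {x : ℝ}, ‖y‖ < 1 / ((N : ℝ) + 1) → |x| < 1 / ((N : ℝ) + 1) →
      ‖(Fin.snoc (α := fun _ => ℝ) y x : Fin (m + 1) → ℝ)‖ < 1 / ((N : ℝ) + 1) := by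
    intro y x hy hx
    rw [pi_norm_lt_iff (by positivity)]
    intro i
    refine Fin.lastCases ?_ (fun i => ?_) i
    · simpa using hx
    · simpa using (norm_le_pi_norm y i).trans_lt hy
  have habs : ∀ x ∈ Set.Ioo 0 (1 / ((N : ℝ) + 1)), |x| < 1 / ((N : ℝ) + 1) := fun x hx => by
    rw [abs_of_pos hx.1]; exact hx.2
  refine ⟨fun j t => h j (t • v), fun x t => g (Fin.snoc (α := fun _ => ℝ) (t • v) x),
    fun j => ?_, fun x hx => ?_, fun x hx t ht => ?_⟩
  · simpa using hNh j 0 v (by simpa using htv) hv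
  · have := hNg (Fin.snoc (α := fun _ => ℝ) 0 x) (Fin.snoc (α := fun _ => ℝ) v 0)
      (fun t ht => by rw [hpt]; exact hsnoc (htv t ht) (habs x hx))
      (hsnoc hv (by simp; positivity))
    simpa only [hpt] using this
  · have := hεeq (Fin.snoc (α := fun _ => ℝ) (t • v) x)
      (by simpa using (hsnoc (htv t ht) (habs x hx)).trans hNε)
    simpa [monicPolyGerm] using this

/-! ### Algebraic division and interpolation at complex roots -/

/-- Division of a polynomial in the last variable by a monic polynomial whose coefficients belong to
a ring of functions: quotient and remainder have their coefficients in the same ring. -/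
theorem exists_polynomial_division (S : Subalgebra ℂ (ℝ → ℂ)) {m d : ℕ}
    (a : Fin d → ((Fin m → ℝ) → ℂ)) (v : Fin m → ℝ) (ha : ∀ j, (fun t : ℝ => a j (t • v)) ∈ S)
    (P : Polynomial ℂ) :
    ∃ (n : ℕ) (q : Fin n → ℝ → ℂ) (ρ : Fin d → ℝ → ℂ), (∀ i, q i ∈ S) ∧ (∀ j, ρ j ∈ S) ∧
      ∀ (t : ℝ) (z : ℂ), P.eval z = monicPoly a (t • v) z * ∑ i, q i t * z ^ (i : ℕ) +
        ∑ j, ρ j t * z ^ (j : ℕ) := by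
  classical
  let α : Fin d → S := fun j => ⟨_, ha j⟩
  let low : Polynomial S := ∑ j : Fin d, Polynomial.C (α j) * Polynomial.X ^ (d - ((j : ℕ) + 1))
  have hlow : low.degree < d := by
    refine Polynomial.mem_degreeLT.1 (sum_mem fun j _ => Polynomial.mem_degreeLT.2 ?_)
    refine (Polynomial.degree_C_mul_X_pow_le _ _).trans_lt ?_
    have := j.2
    exact_mod_cast (by omega : d - ((j : ℕ) + 1) < d)
  let Φ : Polynomial S := Polynomial.X ^ d + low
  have hΦ : Φ.Monic := Polynomial.monic_X_pow_add hlow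
  have hΦd : Φ.degree = d := by
    rw [Polynomial.degree_add_eq_left_of_degree_lt (by rwa [Polynomial.degree_X_pow]),
      Polynomial.degree_X_pow]
  let ev : ℝ → S →+* ℂ := fun t => (Pi.evalRingHom (fun _ : ℝ => ℂ) t).comp S.subtype
  have hev : ∀ t (s : S), ev t s = s.1 t := fun _ _ => rfl
  let PS : Polynomial S := P.map (algebraMap ℂ S)
  have heval : ∀ (t : ℝ) (z : ℂ) (n : ℕ) (R : Polynomial S), R.degree < n →
      R.eval₂ (ev t) z = ∑ j : Fin n, (R.coeff j).1 t * z ^ (j : ℕ) := by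
    intro t z n R hR
    rw [Polynomial.eval₂_eq_sum, ← Polynomial.sum_fin (fun e b => (ev t) b * z ^ e) (by simp) hR]
    rfl
  have hR : (PS %ₘ Φ).degree < d := hΦd ▸ Polynomial.degree_modByMonic_lt PS hΦ
  refine ⟨(PS /ₘ Φ).natDegree + 1, fun i => ((PS /ₘ Φ).coeff i).1,
    fun j => ((PS %ₘ Φ).coeff j).1, fun i => ((PS /ₘ Φ).coeff i).2,
    fun j => ((PS %ₘ Φ).coeff j).2, fun t z => ?_⟩
  have h1 : PS.eval₂ (ev t) z = P.eval z := by
    rw [Polynomial.eval₂_map, Polynomial.eval]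
    congr 1
  have h2 : Φ.eval₂ (ev t) z = monicPoly a (t • v) z := by
    simp [Φ, low, Polynomial.eval₂_finsetSum, monicPoly, hev, α]
  rw [← h1, ← h2, ← heval t z d _ hR, ← heval t z _ (PS /ₘ Φ)
    (Polynomial.degree_le_natDegree.trans_lt (by exact_mod_cast Nat.lt_succ_self _)),
    ← Polynomial.eval₂_mul, ← Polynomial.eval₂_add, add_comm, Polynomial.modByMonic_add_div]

/-- In a quasianalytic class, the remainder of a polynomial in the last variable interpolates it at
the complex roots of the divisor. -/
theorem eval_eq_sum_of_root {M : ℕ → ℝ} (hM : IsWeightSequence M) {m₀ : ℕ}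
    (hqa : IsQuasianalytic (m₀ + 1) M) {m d : ℕ} {a : Fin d → ((Fin m → ℝ) → ℂ)}
    (ha0 : ∀ j, a j 0 = 0) {v : Fin m → ℝ}
    (ha : ∀ j, (fun t : ℝ => a j (t • v)) ∈ carlemanSubalgebra hM) {r : ℝ} (hr : 0 < r)
    {P : Polynomial ℂ} {h : Fin d → ℝ → ℂ} {γ : ℝ → ℝ → ℂ}
    (hh : ∀ j, h j ∈ carlemanSubalgebra hM)
    (hγ : ∀ x ∈ Set.Ioo 0 r, ContDiffOn ℝ ∞ (γ x) symmInterval)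
    (hγb : ∀ k, ∃ G, ∀ x ∈ Set.Ioo 0 r, ‖iteratedDeriv k (γ x) 0‖ ≤ G)
    (heq : ∀ x ∈ Set.Ioo 0 r, ∀ t ∈ symmInterval, P.eval (x : ℂ) =
      monicPoly a (t • v) x * γ x t + ∑ j, h j t * (x : ℂ) ^ (j : ℕ))
    {t : ℝ} (ht : t ∈ symmInterval) {z : ℂ} (hz : monicPoly a (t • v) z = 0) :
    P.eval z = ∑ j, h j t * z ^ (j : ℕ) := by
  obtain ⟨n, q, ρ, hq, hρ, hP⟩ := exists_polynomial_division _ a v ha P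
  have h0 : (0 : ℝ) ∈ symmInterval := by simp
  have hS := fun {w} hw => contDiffOn_of_mem_carlemanSubalgebra hM (w := w) hw
  have hQ : ∀ x : ℝ, ContDiffOn ℝ ∞ (fun t => ∑ i, q i t * (x : ℂ) ^ (i : ℕ)) symmInterval :=
    fun x => ContDiffOn.sum fun i _ => (hS (hq i)).mul contDiffOn_const
  have hQd : ∀ (x : ℝ) (k : ℕ), iteratedDeriv k (fun t => ∑ i, q i t * (x : ℂ) ^ (i : ℕ)) 0
      = ∑ i : Fin n, (x : ℂ) ^ (i : ℕ) * iteratedDeriv k (q i) 0 := by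
    intro x k
    have hc := fun i => (hS (hq i)).contDiffAt_symmInterval k h0
    rw [iteratedDeriv_fun_sum fun i _ => (hc i).mul contDiffAt_const]
    refine Finset.sum_congr rfl fun i _ => ?_
    simp only [mul_comm _ ((x : ℂ) ^ (i : ℕ))]
    rw [iteratedDeriv_const_mul _ (hc i)]
  -- Shrinking to `min r 1` gives `x ^ i ≤ 1`, which bounds the derivatives of the algebraic
  -- quotient uniformly in `x`.
  have hflat := fun k j => iteratedDeriv_eq_zero_of_division (r := min r 1)
    (φ := fun x t => monicPoly a (t • v) x)
    (γ := fun x => γ x - fun t => ∑ i, q i t * (x : ℂ) ^ (i : ℕ))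
    (η := fun j => h j - ρ j) (by positivity)
    (fun x _ => contDiffOn_const.add
      (ContDiffOn.sum fun j _ => (hS (ha j)).mul contDiffOn_const))
    (fun x _ => by simp [monicPoly, ha0])
    (fun x hx => (hγ x ⟨hx.1, hx.2.trans_le (min_le_left _ _)⟩).sub (hQ x))
    (fun k => by
      obtain ⟨G, hG⟩ := hγb k
      refine ⟨G + ∑ i, ‖iteratedDeriv k (q i) 0‖, fun x hx => ?_⟩
      have hx' : x ∈ Set.Ioo 0 r := ⟨hx.1, hx.2.trans_le (min_le_left _ _)⟩
      rw [iteratedDeriv_sub ((hγ x hx').contDiffAt_symmInterval k h0)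
        ((hQ x).contDiffAt_symmInterval k h0), hQd]
      refine norm_sub_le_of_le (hG x hx') (norm_sum_le_of_le _ fun i _ => ?_)
      rw [norm_mul, norm_pow, Complex.norm_real, Real.norm_of_nonneg hx.1.le]
      exact mul_le_of_le_one_left (norm_nonneg _)
        (pow_le_one₀ hx.1.le (hx.2.le.trans (min_le_right _ _))))
    (fun j => (hS (hh j)).sub (hS (hρ j)))
    (fun x hx t ht => by
      have h1 := heq x ⟨hx.1, hx.2.trans_le (min_le_left _ _)⟩ t ht
      rw [hP t x] at h1
      simp only [Pi.sub_apply, sub_mul, Finset.sum_sub_distrib, mul_sub]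
      linear_combination -h1) k j
  have hrem : ∀ j, h j t = ρ j t := fun j => sub_eq_zero.1
    (hqa.eq_zero_of_flat hM (sub_mem (hh j) (hρ j)) (fun k => hflat k j) ht)
  rw [hP t z, hz, zero_mul, zero_add]
  simp only [hrem]

/-! ### Test polynomials that are large off the real axis -/

theorem iteratedDeriv_polynomial_eval (P : Polynomial ℂ) (k : ℕ) :
    iteratedDeriv k (fun z => P.eval z) = fun z => (Polynomial.derivative^[k] P).eval z := by
  induction k with
  | zero => simp
  | succ k ih =>
    rw [iteratedDeriv_succ, ih, Function.iterate_succ_apply']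
    ext z
    exact Polynomial.deriv _

/-- Powers of `1 - ((z - u) / L)²`, suitably scaled, satisfy the Carleman bounds. -/
theorem smul_pow_mem_unitPolynomials {M : ℕ → ℝ} {u L ε c : ℝ} (hL : 1 + |u| ≤ L)
    (hε : 0 < ε) (hε1 : ε ≤ 1) (hc : 0 < c) (hcM : ∀ j, c * (1 / ε) ^ j ≤ M j) (K : ℕ) :
    Polynomial.C ((c / (1 + 3 * ε) ^ K : ℝ) : ℂ) *
      (1 - (Polynomial.C ((1 / L : ℝ) : ℂ) * (Polynomial.X - Polynomial.C (u : ℂ))) ^ 2) ^ K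
        ∈ unitPolynomials M := by
  intro k t ht
  set p : Polynomial ℂ := 1 - (Polynomial.C ((1 / L : ℝ) : ℂ) *
    (Polynomial.X - Polynomial.C (u : ℂ))) ^ 2 with hp
  have hL1 : 1 ≤ L := by linarith [abs_nonneg u]
  have hL0 : 0 < L := by linarith
  -- Moving by `ε` from the real point `t` changes the value by at most `ε * (ε + 2) ≤ 3 * ε`, as `L
  -- ≥ 1` and `ε ≤ 1`.
  have hsphere : ∀ z ∈ Metric.sphere (t : ℂ) ε, ‖p.eval z‖ ≤ 1 + 3 * ε := by
    intro z hz
    rw [mem_sphere_iff_norm] at hz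
    have he : p.eval z = ((1 - ((t - u) / L) ^ 2 : ℝ) : ℂ) -
        (((1 / L : ℝ) : ℂ) * (z - t)) * (((1 / L : ℝ) : ℂ) * (z - t) +
          ((2 * ((t - u) / L) : ℝ) : ℂ)) := by
      simp only [hp, Polynomial.eval_sub, Polynomial.eval_one, Polynomial.eval_pow,
        Polynomial.eval_mul, Polynomial.eval_C, Polynomial.eval_X]
      push_cast
      ring
    have htu : |(t - u) / L| ≤ 1 := by
      rw [abs_div, abs_of_pos hL0, div_le_one hL0]
      refine le_trans (abs_sub _ _) (le_trans ?_ hL)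
      gcongr
      exact abs_le.2 ⟨ht.1.le, ht.2.le⟩
    have h1 : ‖((1 - ((t - u) / L) ^ 2 : ℝ) : ℂ)‖ ≤ 1 := by
      rw [Complex.norm_real, Real.norm_eq_abs, abs_le]
      have := (sq_le_one_iff_abs_le_one _).2 htu
      constructor <;> nlinarith [sq_nonneg ((t - u) / L)]
    have h2 : ‖((1 / L : ℝ) : ℂ) * (z - t)‖ ≤ ε := by
      rw [norm_mul, hz, Complex.norm_real, Real.norm_of_nonneg (by positivity)]
      refine mul_le_of_le_one_left hε.le ?_
      rw [div_le_one hL0]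
      exact hL1
    have h3 : ‖((2 * ((t - u) / L) : ℝ) : ℂ)‖ ≤ 2 := by
      rw [Complex.norm_real, norm_mul, Real.norm_eq_abs, Real.norm_eq_abs]
      rw [abs_of_pos (two_pos : (0 : ℝ) < 2)]
      linarith
    rw [he]
    refine (norm_sub_le_of_le h1 (norm_mul_le_of_le h2 (norm_add_le_of_le h2 h3))).trans ?_
    nlinarith
  have hcauchy := Complex.norm_iteratedDeriv_le_of_forall_mem_sphere_norm_le
    (f := fun z => (p ^ K).eval z) (c := (t : ℂ)) (C := (1 + 3 * ε) ^ K) k hε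
    (p ^ K).differentiable.diffContOnCl (fun z hz => by
      rw [Polynomial.eval_pow, norm_pow]
      gcongr
      exact hsphere z hz)
  rw [iteratedDeriv_polynomial_eval] at hcauchy
  rw [Polynomial.iterate_derivative_C_mul, Polynomial.eval_mul, Polynomial.eval_C, norm_mul,
    Complex.norm_real, Real.norm_of_nonneg (by positivity)]
  calc _ ≤ c / (1 + 3 * ε) ^ K * (k.factorial * (1 + 3 * ε) ^ K / ε ^ k) := by gcongr
    _ = k.factorial * (c * (1 / ε) ^ k) := by
      rw [one_div, inv_pow]
      field_simp
    _ ≤ k.factorial * M k := by gcongr; exact hcM k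
    _ = carlemanBound M 1 1 k := by simp [carlemanBound]

/-! ### Conclusion -/

theorem theorem3p3 (M : ℕ → ℝ) (hM : IsWeightSequence M) (m d : ℕ)
    (hqa : IsQuasianalytic (m + 1) M)
    (hstrict : analyticGerms (m + 1) ⊂ carlemanGerms (m + 1) M)
    (a : Fin d → ((Fin m → ℝ) → ℂ)) (ha : IsDistinguished M a)
    (hdiv : WeierstrassDivisionHolds M d (monicPolyGerm a)) :
    IsHyperbolic a := by
  classical
  -- Baire: some `N` works on a whole ball of series.
  obtain ⟨N, hN⟩ := nonempty_interior_of_iUnion_of_closed (isClosed_divisibleSeries M a)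
    (Set.eq_univ_of_forall fun c =>
      Set.mem_iUnion.2 (eventually_mem_divisibleSeries hM hdiv c).exists)
  obtain ⟨c₀, hc₀⟩ := hN
  obtain ⟨δ, hδ, hball⟩ := Metric.mem_nhds_iff.1 (mem_interior_iff_mem_nhds.1 hc₀)
  obtain ⟨N', hN'⟩ := (eventually_all.2 fun j =>
    eventually_line_mem_boundedJets hM (ha j).1).exists
  set s : ℝ := min (1 / ((N : ℝ) + 1)) (1 / ((N' : ℝ) + 1)) / 2 with hs
  have hs0 : 0 < s := by positivity
  refine ⟨Metric.ball 0 s, Metric.ball_mem_nhds _ hs0, fun x' hx' z hz => ?_⟩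
  by_contra him
  -- Doubling places `x'` at the interior parameter `t = 1 / 2` of the line; hence the factor `1 /
  -- 2` in `s`.
  set v : Fin m → ℝ := (2 : ℝ) • x' with hv
  have hvs : ‖v‖ < min (1 / ((N : ℝ) + 1)) (1 / ((N' : ℝ) + 1)) := by
    rw [mem_ball_zero_iff] at hx'
    rw [hv, norm_smul, Real.norm_of_nonneg zero_le_two]
    linarith
  have hvN := hvs.trans_le (min_le_left _ _)
  have hvN' := hvs.trans_le (min_le_right _ _)
  have haS : ∀ j, (fun t : ℝ => a j (t • v)) ∈ carlemanSubalgebra hM := fun j =>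
    ⟨N' + 1, by positivity, N' + 1, by positivity, by
      simpa using hN' j 0 v (fun t ht => by
        rw [zero_add, norm_smul]
        exact (mul_le_of_le_one_left (norm_nonneg _)
          (abs_le.2 ⟨ht.1.le, ht.2.le⟩)).trans_lt hvN') hvN'⟩
  set B := carlemanBound M (N + 1) (N + 1) with hB
  have hhalf : (1 / 2 : ℝ) ∈ symmInterval := by norm_num
  have h0 : (0 : ℝ) ∈ symmInterval := by simp
  have hroot : monicPoly a ((1 / 2 : ℝ) • v) z = 0 := by
    rw [hv, smul_smul]
    norm_num [hz]
  -- the values of the unit polynomials at the root are uniformly bounded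
  have hbound : ∀ P ∈ unitPolynomials M,
      δ / 2 * ‖P.eval z‖ ≤ ∑ j : Fin d, (B 0 + B 0) * ‖z‖ ^ (j : ℕ) := by
    intro P hP
    set e : PolynomialSeries M := lp.single 1 ⟨P, hP⟩ ((δ / 2 : ℝ) : ℂ) with he
    have hmem : c₀ + e ∈ divisibleSeries M a N := by
      refine hball ?_
      rw [mem_ball_iff_norm, add_sub_cancel_left, he, lp.norm_single (by simp),
        Complex.norm_real, Real.norm_of_nonneg (by positivity)]
      linarith
    -- Subtracting the division of `c₀` from that of `c₀ + e` divides `(δ / 2) P`, with bounds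
    -- independent of `P`.
    obtain ⟨h₁, γ₁, H₁⟩ := hmem v hvN
    obtain ⟨h₂, γ₂, H₂⟩ := (hball (Metric.mem_ball_self hδ)) v hvN
    have hS : ∀ {w}, w ∈ boundedJets B → w ∈ carlemanSubalgebra hM := fun hw =>
      ⟨N + 1, by positivity, N + 1, by positivity, hw⟩
    have heval : (Polynomial.C ((δ / 2 : ℝ) : ℂ) * P).eval z
        = ∑ j, (h₁ j - h₂ j) (1 / 2) * z ^ (j : ℕ) := by
      refine eval_eq_sum_of_root hM hqa (fun j => (ha j).2) haS
        (r := 1 / ((N : ℝ) + 1)) (by positivity)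
        (h := fun j => h₁ j - h₂ j) (γ := fun x => γ₁ x - γ₂ x)
        (fun j => sub_mem (hS (H₁.remainder_mem j)) (hS (H₂.remainder_mem j)))
        (fun x hx => (H₁.quotient_mem x hx).1.sub (H₂.quotient_mem x hx).1)
        (fun k => ⟨B k + B k, fun x hx => ?_⟩) (fun x hx t ht => ?_) hhalf hroot
      · rw [iteratedDeriv_sub ((H₁.quotient_mem x hx).1.contDiffAt_symmInterval k h0)
          ((H₂.quotient_mem x hx).1.contDiffAt_symmInterval k h0)]
        exact norm_sub_le_of_le ((H₁.quotient_mem x hx).2 k 0 h0)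
          ((H₂.quotient_mem x hx).2 k 0 h0)
      · have hxI : x ∈ symmInterval := by
          refine ⟨by linarith [hx.1], hx.2.trans_le ?_⟩
          rw [div_le_one (by positivity)]
          linarith [N.cast_nonneg (α := ℝ)]
        have h1 := PolynomialSeries.derivSum_sub (c₀ + e) c₀ 0 hxI
        rw [add_sub_cancel_left, he, PolynomialSeries.derivSum_single, ← he, H₁.eq x hx t ht,
          H₂.eq x hx t ht] at h1
        rw [Polynomial.eval_mul, Polynomial.eval_C]
        simp only [Pi.sub_apply, sub_mul, Finset.sum_sub_distrib, mul_sub]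
        linear_combination h1
    have hnorm := congrArg norm heval
    rw [Polynomial.eval_mul, Polynomial.eval_C, norm_mul, Complex.norm_real,
      Real.norm_of_nonneg (by positivity)] at hnorm
    rw [hnorm]
    refine norm_sum_le_of_le _ fun j _ => ?_
    rw [norm_mul, norm_pow]
    gcongr
    have h1 := (H₁.remainder_mem j).2 0 _ hhalf
    have h2 := (H₂.remainder_mem j).2 0 _ hhalf
    rw [iteratedDeriv_zero] at h1 h2
    exact norm_sub_le_of_le h1 h2
  -- At `z` the base polynomial equals `1 + τ`, while `ε ≤ τ / 6` keeps it at most `1 + τ / 2` in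
  -- norm within `ε` of the interval. The ratio therefore exceeds `1`, and its powers outgrow the
  -- uniform bound.
  set L : ℝ := 1 + |z.re| with hL
  have hL0 : 0 < L := by positivity
  set τ : ℝ := (z.im / L) ^ 2 with hτ
  have hτ0 : 0 < τ := by positivity
  set ε : ℝ := min 1 (τ / 6) with hε
  have hε0 : 0 < ε := by positivity
  obtain ⟨c, hc, hcM⟩ := exists_mul_pow_le_of_analyticGerms_ssubset hM hstrict
    (A := 1 / ε) (by positivity)
  have hq : 1 < (1 + τ) / (1 + 3 * ε) := by
    rw [one_lt_div (by positivity)]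
    have : ε ≤ τ / 6 := min_le_right _ _
    linarith
  have hlim : Tendsto (fun K : ℕ => δ / 2 * (c * ((1 + τ) / (1 + 3 * ε)) ^ K)) atTop atTop :=
    ((tendsto_pow_atTop_atTop_of_one_lt hq).const_mul_atTop hc).const_mul_atTop (by positivity)
  obtain ⟨K, hK⟩ :=
    (hlim.eventually_gt_atTop (∑ j : Fin d, (B 0 + B 0) * ‖z‖ ^ (j : ℕ))).exists
  refine hK.not_ge ?_
  have h1 := hbound _ (smul_pow_mem_unitPolynomials (u := z.re) le_rfl hε0 (min_le_left _ _) hc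
    hcM K)
  refine le_trans (le_of_eq ?_) h1
  have hval : (1 - (Polynomial.C ((1 / L : ℝ) : ℂ) *
      (Polynomial.X - Polynomial.C (z.re : ℂ))) ^ 2).eval z = ((1 + τ : ℝ) : ℂ) := by
    have hzre : z - z.re = z.im * Complex.I := by
      linear_combination -(Complex.re_add_im z)
    simp only [Polynomial.eval_sub, Polynomial.eval_one, Polynomial.eval_pow,
        Polynomial.eval_mul, Polynomial.eval_C, Polynomial.eval_X, hzre, hτ]
    push_cast
    linear_combination (-(1 / (L : ℂ)) ^ 2 * (z.im : ℂ) ^ 2) * Complex.I_sq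
  rw [Polynomial.eval_mul, Polynomial.eval_C, Polynomial.eval_pow, hval, norm_mul, norm_pow,
    Complex.norm_real, Complex.norm_real, Real.norm_of_nonneg (by positivity),
    Real.norm_of_nonneg (by positivity), div_pow]
  ring
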